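/- Let $A$ be a unital $C^*$-algebra, let $U(A)=\{u\in A : uu^*=u^*u=1\}$ be its unitary group with the norm topology, and let $U_A$ be the connected component of $1$ in $U(A)$. For a closed two-sided ideal $I\subseteq A$ let $U_I$ be the connected component of $1$ in the group $U(I)=\{u\in U(A) : u-1\in I\}$, and let $CU_I=\overline{(U_I,U_I)}$ be the closure of the subgroup generated by the commutators $uvu^{-1}v^{-1}$ with $u,v\in U_I$; it is a subgroup of $U_A$. Call a closed two-sided ideal $I$ of $A$ *perfect* if $I$ is the closed two-sided ideal of $A$ generated by the linear span $[I,I]$ of the commutators $xy-yx$ with $x,y\in I$, and call a closed subgroup $H$ of $U_A$ *topologically perfect* if $H=\overline{(H,H)}$. **Theorem.** The map $I\mapsto CU_I$ is a bijection from the set of perfect ideals of $A$ onto the set of topologically perfect closed normal subgroups of $U_A$. -/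

import Mathlib

namespace CStarUnitary

section Groups

variable {G : Type*} [Group G] [TopologicalSpace G] [IsTopologicalGroup G]

/-- The closure of the commutator subgroup `(H, H)` of a subgroup `H` of a topological group. -/
def closedCommutator (H : Subgroup G) : Subgroup G :=
  ⁅H, H⁆.topologicalClosure

/-- A (closed) subgroup is topologically perfect if it is equal to the closure of its own
commutator subgroup. -/
def IsTopologicallyPerfect (H : Subgroup G) : Prop :=
  H = closedCommutator H

end Groups

section Ideals

variable {A : Type*} [CStarAlgebra A]

/-- `[S, T]`: the linear span of the commutators `x y - y x` with `x ∈ S`, `y ∈ T`. -/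
noncomputable def commutatorSpan (S T : Set A) : Submodule ℂ A :=
  Submodule.span ℂ {z : A | ∃ x ∈ S, ∃ y ∈ T, z = x * y - y * x}

/-- `Id_A(S)`: the closed two-sided ideal of `A` generated by `S`, i.e. the intersection of all
closed two-sided ideals that contain `S`. -/
def closedIdealSpan (S : Set A) : TwoSidedIdeal A :=
  sInf {J : TwoSidedIdeal A | IsClosed (J : Set A) ∧ S ⊆ (J : Set A)}

theorem coe_closedIdealSpan (S : Set A) :
    (closedIdealSpan S : Set A) =
      ⋂ J ∈ {J : TwoSidedIdeal A | IsClosed (J : Set A) ∧ S ⊆ (J : Set A)}, (J : Set A) := by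
  ext x
  simp [closedIdealSpan, TwoSidedIdeal.mem_sInf]

theorem isClosed_closedIdealSpan (S : Set A) : IsClosed (closedIdealSpan S : Set A) := by
  rw [coe_closedIdealSpan]
  exact isClosed_biInter fun J hJ => hJ.1

theorem subset_closedIdealSpan (S : Set A) : S ⊆ (closedIdealSpan S : Set A) := by
  rw [coe_closedIdealSpan]
  exact Set.subset_iInter₂ fun J hJ => hJ.2

/-- A perfect ideal of `A`: a closed two-sided ideal `I` with `I = Id_A([I, I])`. -/
def IsPerfectIdeal (I : TwoSidedIdeal A) : Prop :=
  IsClosed (I : Set A) ∧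
    I = closedIdealSpan (commutatorSpan (I : Set A) (I : Set A) : Set A)

end Ideals

section Unitaries

variable (A : Type*) [CStarAlgebra A]

/-- `U_A`: the connected component of the unit in the unitary group of `A`, which carries the
norm topology. -/
def connectedUnitary : Subgroup (unitary A) :=
  Subgroup.connectedComponentOfOne (unitary A)

variable {A}

/-- `U(I)`: the group of all unitaries `u` of `A` with `u - 1 ∈ I`. -/
def idealUnitary (I : TwoSidedIdeal A) : Subgroup (unitary A) where
  carrier := {u : unitary A | (u : A) - 1 ∈ I}
  one_mem' := by
    change ((1 : unitary A) : A) - 1 ∈ I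
    simp
  mul_mem' := by
    intro u v hu hv
    change ((u * v : unitary A) : A) - 1 ∈ I
    have h : ((u * v : unitary A) : A) - 1 = (u : A) * ((v : A) - 1) + ((u : A) - 1) := by
      push_cast
      noncomm_ring
    rw [h]
    exact I.add_mem (I.mul_mem_left _ _ hv) hu
  inv_mem' := by
    intro u hu
    change ((u⁻¹ : unitary A) : A) - 1 ∈ I
    have h : ((u⁻¹ : unitary A) : A) - 1 = -(((u⁻¹ : unitary A) : A) * ((u : A) - 1)) := by
      have h1 : ((u⁻¹ : unitary A) : A) * (u : A) = 1 := by
        rw [← Submonoid.coe_mul, inv_mul_cancel, Submonoid.coe_one]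
      rw [mul_sub, h1, mul_one, neg_sub]
    rw [h]
    exact I.neg_mem (I.mul_mem_left _ _ hu)

/-- `U_I`: the connected component of the unit of `U(I)`, as a subgroup of the unitary group
of `A`. -/
def connectedIdealUnitary (I : TwoSidedIdeal A) : Subgroup (unitary A) :=
  (Subgroup.connectedComponentOfOne (idealUnitary I)).map (idealUnitary I).subtype

/-- `CU_I`: the closure of the commutator subgroup `(U_I, U_I)`. -/
def CU (I : TwoSidedIdeal A) : Subgroup (unitary A) :=
  closedCommutator (connectedIdealUnitary I)

theorem connectedIdealUnitary_le (I : TwoSidedIdeal A) :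
    connectedIdealUnitary I ≤ connectedUnitary A := by
  rintro _ ⟨u, hu, rfl⟩
  have h := (continuous_subtype_val (p := fun u => u ∈ idealUnitary I)).image_connectedComponent_subset
    (1 : idealUnitary I)
  exact h ⟨u, hu, rfl⟩

theorem isClosed_connectedUnitary : IsClosed (connectedUnitary A : Set (unitary A)) :=
  isClosed_connectedComponent

theorem CU_le (I : TwoSidedIdeal A) : CU I ≤ connectedUnitary A :=
  Subgroup.topologicalClosure_minimal _
    ((Subgroup.commutator_mono (connectedIdealUnitary_le I) (connectedIdealUnitary_le I)).trans
      (Subgroup.commutator_le_self _))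
    isClosed_connectedUnitary

/-- `CU_I`, regarded as a subgroup of `U_A`; nothing is cut off here, by `CU_le`. -/
def CUIn (I : TwoSidedIdeal A) : Subgroup (connectedUnitary A) :=
  (CU I).subgroupOf (connectedUnitary A)

theorem map_CUIn (I : TwoSidedIdeal A) :
    (CUIn I).map (connectedUnitary A).subtype = CU I :=
  Subgroup.map_subgroupOf_eq_of_le (CU_le I)

end Unitaries

end CStarUnitary

/-!
A closed subgroup `K` of the unitary group has a Lie algebra, the closed real space of selfadjoint
`a` with `exp (i t a) ∈ K` for all real `t`; its complexification `complexLie K` is a closed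
subspace of `A`. The correspondence between closed normal subgroups of `U_A` and closed ideals is
the shadow of Herstein's correspondence between Lie ideals and ideals.

*The group contains `CU_I`.* Let `K` be closed and normalized by `U_A`, and let `I` be the closed
ideal generated by `[K, A]`. Then `complexLie K` is a Lie ideal, and for `u ∈ K` it contains all
`u a u* - a`, the velocity at `0` of the group commutators of `u` with `exp (i t a)`
(`unitaryConj_sub_mem_complexLie`). A Herstein argument, which needs only that closed ideals of a
C*-algebra are semiprime, shows that a closed Lie ideal `L` contains `[J, A]`, where `J` is the
closed ideal generated by `[L, A]` (`commutator_mem_of_mem_closedIdealSpan_commutator`); moreover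
`I ≤ J` for `L = complexLie K` (`commutator_mem_of_conj_sub_central`). So `complexLie K` contains
`[I, A]`, and the Lie–Trotter formula turns this into `(U_I, U_A) ≤ K`, as `U_I` and `U_A` are
generated by exponentials (`commutator_connectedIdealUnitary_le`). In particular `CU_I ≤ K`, and the
same lemma applied to `CU_I` gives `(U_I, U_A) ≤ CU_I`.

*Perfect ideals.* If `I` is perfect and the closed commutator subgroup of `CU_I` is central modulo a
closed ideal `J`, then, on the level of Lie algebras, `[[I, I], [I, I]]` is central modulo `J`. By
Herstein's method `[I, I] ⊆ J`, hence `I ≤ J` (`IsPerfectIdeal.le_of_commutator_mem`). This shows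
both that `I` is the closed ideal generated by `[CU_I, A]`, which is injectivity, and that `CU_I` is
topologically perfect.

*Surjectivity.* If `K ≤ U_A` is topologically perfect and normal, and `I` is the closed ideal
generated by `[K, A]`, then `(K, K) ≤ U_I`, so that `K` is the closure of `(K, K)`, which is
contained in the closure of `((K, K), K)` and so in that of `(U_I, U_A)`; thus `K ≤ CU_I`. Modulo
the closed ideal generated by `[I, I]` the group `CU_I = K` is trivial, which forces `I` to be
perfect.
-/

namespace CStarUnitary

open scoped commutatorElement
open selfAdjoint Filter Topology Complex

/-! ### Closed two-sided ideals -/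

section ClosedIdeals

variable {A : Type*} [CStarAlgebra A]

theorem smul_mem_ideal (J : TwoSidedIdeal A) (c : ℂ) {x : A} (hx : x ∈ J) : c • x ∈ J := by
  have h := J.mul_mem_left (c • 1) x hx
  rwa [smul_mul_assoc, one_mul] at h

/-- A two-sided ideal, regarded as a complex subspace. -/
def idealSubmodule (J : TwoSidedIdeal A) : Submodule ℂ A where
  carrier := J
  add_mem' := J.add_mem
  zero_mem' := J.zero_mem
  smul_mem' c _ hx := smul_mem_ideal J c hx

theorem mem_idealSubmodule {J : TwoSidedIdeal A} {x : A} : x ∈ idealSubmodule J ↔ x ∈ J :=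
  Iff.rfl

/-- Every `w` is a limit of elements `w (w* w) k`: take `k = p (p² + δ²)⁻¹` with `p = w* w`. This
replaces approximate units. -/
theorem exists_norm_sub_mul_lt (w : A) {ε : ℝ} (hε : 0 < ε) :
    ∃ k : A, ‖w - w * (star w * w * k)‖ < ε := by
  set p := star w * w with hp
  have hpsa : IsSelfAdjoint p := IsSelfAdjoint.star_mul_self w
  set δ : ℝ := ε ^ 2 with hδ
  have hδ0 : 0 < δ := by positivity
  have hden : ∀ t : ℝ, δ ^ 2 + t ^ 2 ≠ 0 := fun t => by positivity
  have hkc : Continuous fun t : ℝ => t / (δ ^ 2 + t ^ 2) := by fun_prop (disch := exact hden _)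
  have hgc : Continuous fun t : ℝ => δ ^ 2 / (δ ^ 2 + t ^ 2) := by fun_prop (disch := exact hden _)
  set k : A := cfc (fun t : ℝ => t / (δ ^ 2 + t ^ 2)) p
  set g : A := cfc (fun t : ℝ => δ ^ 2 / (δ ^ 2 + t ^ 2)) p
  have hpk : p * k = 1 - g := by
    have h1 : p * k = cfc (fun t : ℝ => t * (t / (δ ^ 2 + t ^ 2))) p := by
      rw [cfc_mul (fun t : ℝ => t) (fun t : ℝ => t / (δ ^ 2 + t ^ 2)) p
        continuous_id.continuousOn hkc.continuousOn, cfc_id' ℝ p]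
    have h2 : 1 - g = cfc (fun t : ℝ => 1 - δ ^ 2 / (δ ^ 2 + t ^ 2)) p := by
      rw [cfc_sub (fun _ : ℝ => (1 : ℝ)) (fun t : ℝ => δ ^ 2 / (δ ^ 2 + t ^ 2)) p
        continuousOn_const hgc.continuousOn, cfc_const_one ℝ p]
    rw [h1, h2]
    congr 1
    funext t
    have := hden t
    field_simp
    ring
  refine ⟨k, ?_⟩
  have hgsa : star g = g := (cfc_predicate (fun t : ℝ => δ ^ 2 / (δ ^ 2 + t ^ 2)) p : IsSelfAdjoint _)
  have hw : w - w * (p * k) = w * g := by rw [hpk]; noncomm_ring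
  have hgpg : star (w * g) * (w * g) =
      cfc (fun t : ℝ => δ ^ 2 / (δ ^ 2 + t ^ 2) * t * (δ ^ 2 / (δ ^ 2 + t ^ 2))) p := by
    rw [cfc_mul (fun t : ℝ => δ ^ 2 / (δ ^ 2 + t ^ 2) * t) (fun t : ℝ => δ ^ 2 / (δ ^ 2 + t ^ 2)) p
      (hgc.mul continuous_id).continuousOn hgc.continuousOn,
      cfc_mul (fun t : ℝ => δ ^ 2 / (δ ^ 2 + t ^ 2)) (fun t : ℝ => t) p
      hgc.continuousOn continuous_id.continuousOn, cfc_id' ℝ p, star_mul, hgsa, hp]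
    simp only [mul_assoc]
    rfl
  have hb : ‖w * g‖ * ‖w * g‖ ≤ δ / 2 := by
    rw [← CStarRing.norm_star_mul_self, hgpg]
    refine norm_cfc_le (by positivity) fun t _ => ?_
    have hd : 0 < δ ^ 2 + t ^ 2 := by positivity
    rw [norm_mul, norm_mul, Real.norm_eq_abs, Real.norm_eq_abs, abs_of_pos (by positivity)]
    have h1 : δ ^ 2 / (δ ^ 2 + t ^ 2) ≤ 1 := by
      rw [div_le_one hd]; nlinarith [sq_nonneg t]
    have h2 : δ ^ 2 / (δ ^ 2 + t ^ 2) * |t| ≤ δ / 2 := by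
      rw [div_mul_eq_mul_div, div_le_iff₀ hd]
      nlinarith [mul_nonneg hδ0.le (sq_nonneg (δ - |t|)), sq_abs t]
    calc _ ≤ δ / 2 * 1 := by gcongr
      _ = δ / 2 := mul_one _
  rw [hw]
  nlinarith [norm_nonneg (w * g)]

theorem mem_of_forall_exists_norm_sub_lt {S : Set A} (hS : IsClosed S) {w : A}
    (h : ∀ ε > 0, ∃ v ∈ S, ‖w - v‖ < ε) : w ∈ S := by
  rw [← hS.closure_eq, Metric.mem_closure_iff]
  simpa only [dist_eq_norm] using h

/-- Closed ideals of a C*-algebra are semiprime. -/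
theorem mem_of_mul_star_mul_mem {J : TwoSidedIdeal A} (hJ : IsClosed (J : Set A)) {w : A}
    (h : w * star w * w ∈ J) : w ∈ J := by
  refine mem_of_forall_exists_norm_sub_lt hJ fun ε hε => ?_
  obtain ⟨k, hk⟩ := exists_norm_sub_mul_lt w hε
  refine ⟨_, ?_, hk⟩
  have h1 := J.mul_mem_right _ k h
  simpa only [mul_assoc, SetLike.mem_coe] using h1

theorem star_mem_ideal {J : TwoSidedIdeal A} (hJ : IsClosed (J : Set A)) {w : A} (h : w ∈ J) :
    star w ∈ J := by
  refine mem_of_mul_star_mul_mem hJ ?_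
  rw [star_star]
  exact J.mul_mem_right _ _ (J.mul_mem_left _ _ h)

/-- Closed ideals are idempotent: `x ∈ J` is a limit of products `x y` with `y ∈ J`. -/
theorem exists_mem_norm_sub_mul_lt {J : TwoSidedIdeal A} {w : A} (h : w ∈ J) {ε : ℝ} (hε : 0 < ε) :
    ∃ y ∈ J, ‖w - w * y‖ < ε := by
  obtain ⟨k, hk⟩ := exists_norm_sub_mul_lt w hε
  exact ⟨_, J.mul_mem_right _ _ (J.mul_mem_left _ _ h), hk⟩

/-- The linear map `x ↦ x a - a x`. -/
noncomputable def commutatorRight (a : A) : A →ₗ[ℂ] A :=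
  LinearMap.mulRight ℂ a - LinearMap.mulLeft ℂ a

/-- The linear map `x ↦ a x - x a`. -/
noncomputable def commutatorLeft (a : A) : A →ₗ[ℂ] A :=
  LinearMap.mulLeft ℂ a - LinearMap.mulRight ℂ a

theorem mem_comap_commutatorRight {M : Submodule ℂ A} {a x : A} :
    x ∈ M.comap (commutatorRight a) ↔ x * a - a * x ∈ M := by
  simp [commutatorRight]

theorem mem_comap_commutatorLeft {M : Submodule ℂ A} {a x : A} :
    x ∈ M.comap (commutatorLeft a) ↔ a * x - x * a ∈ M := by
  simp [commutatorLeft]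

theorem closedIdealSpan_le {S : Set A} {J : TwoSidedIdeal A} (hJ : IsClosed (J : Set A))
    (h : S ⊆ J) : closedIdealSpan S ≤ J :=
  sInf_le ⟨hJ, h⟩

theorem commutator_mem_ideal_left {J : TwoSidedIdeal A} {x : A} (hx : x ∈ J) (a : A) :
    x * a - a * x ∈ J :=
  J.sub_mem (J.mul_mem_right _ _ hx) (J.mul_mem_left _ _ hx)

theorem commutator_mem_ideal_right {J : TwoSidedIdeal A} {x : A} (hx : x ∈ J) (a : A) :
    a * x - x * a ∈ J :=
  J.sub_mem (J.mul_mem_left _ _ hx) (J.mul_mem_right _ _ hx)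

theorem commutatorSpan_le_idealSubmodule (I : TwoSidedIdeal A) :
    commutatorSpan (I : Set A) (I : Set A) ≤ idealSubmodule I := by
  refine Submodule.span_le.2 ?_
  rintro _ ⟨x, hx, y, -, rfl⟩
  exact commutator_mem_ideal_left hx y

theorem closedIdealSpan_commutatorSpan_le {I : TwoSidedIdeal A} (hI : IsClosed (I : Set A)) :
    closedIdealSpan (commutatorSpan (I : Set A) (I : Set A) : Set A) ≤ I :=
  closedIdealSpan_le hI (commutatorSpan_le_idealSubmodule I)

theorem mul_sub_mul_mem_commutatorSpan {S T : Set A} {x y : A} (hx : x ∈ S) (hy : y ∈ T) :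
    x * y - y * x ∈ commutatorSpan S T :=
  Submodule.subset_span ⟨x, hx, y, hy, rfl⟩

/-- `[I, A]` lies in the closure of `[I, I]`, because `I` is idempotent and
`[x y, a] = [x, y a] + [y, a x]`. -/
theorem commutator_mem_closure_commutatorSpan (I : TwoSidedIdeal A) {x : A} (hx : x ∈ I) (a : A) :
    x * a - a * x ∈ (commutatorSpan (I : Set A) (I : Set A)).topologicalClosure := by
  have hx' : x ∈ closure {z | ∃ y ∈ I, z = x * y} := by
    refine mem_of_forall_exists_norm_sub_lt isClosed_closure fun ε hε => ?_
    obtain ⟨y, hy, h⟩ := exists_mem_norm_sub_mul_lt hx hε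
    exact ⟨_, subset_closure ⟨y, hy, rfl⟩, h⟩
  have hmaps : Set.MapsTo (fun z => z * a - a * z) {z | ∃ y ∈ I, z = x * y}
      (commutatorSpan (I : Set A) (I : Set A) : Set A) := by
    rintro _ ⟨y, hy, rfl⟩
    have : x * y * a - a * (x * y) = (x * (y * a) - y * a * x) + (y * (a * x) - a * x * y) := by
      noncomm_ring
    simp only [this]
    exact Submodule.add_mem _ (mul_sub_mul_mem_commutatorSpan hx (I.mul_mem_right _ _ hy))
      (mul_sub_mul_mem_commutatorSpan hy (I.mul_mem_left _ _ hx))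
  exact hmaps.closure (by fun_prop) hx'

end ClosedIdeals

/-! ### Commutators modulo a closed ideal -/

section Herstein

variable {A : Type*} [CStarAlgebra A]

/-- A square-zero inner derivation of an ideal vanishes, modulo a semiprime ideal: if
`(ad x)² I ⊆ J` then `[x, I] ⊆ J`. -/
theorem commutator_mem_of_ad_sq_mem {I J : TwoSidedIdeal A} (hI : IsClosed (I : Set A))
    (hJ : IsClosed (J : Set A)) {x : A}
    (h : ∀ y ∈ I, x * (x * y - y * x) - (x * y - y * x) * x ∈ J) {y : A} (hy : y ∈ I) :
    x * y - y * x ∈ J := by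
  -- `(ad x)² (y z)` gives `2 [x, y] [x, z] ∈ J` by the Leibniz rule
  have key : ∀ z ∈ I, (x * y - y * x) * (x * z - z * x) ∈ J := by
    intro z hz
    have h2 : (2 : ℂ) • ((x * y - y * x) * (x * z - z * x)) =
        (x * (x * (y * z) - y * z * x) - (x * (y * z) - y * z * x) * x)
        - (x * (x * y - y * x) - (x * y - y * x) * x) * z
        - y * (x * (x * z - z * x) - (x * z - z * x) * x) := by
      rw [two_smul]
      noncomm_ring
    have h3 : (2 : ℂ) • ((x * y - y * x) * (x * z - z * x)) ∈ J := by
      rw [h2]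
      exact J.sub_mem (J.sub_mem (h _ (I.mul_mem_left _ _ hz)) (J.mul_mem_right _ _ (h _ hy)))
        (J.mul_mem_left _ _ (h _ hz))
    have h4 := smul_mem_ideal J (2⁻¹ : ℂ) h3
    rwa [smul_smul, inv_mul_cancel₀ two_ne_zero, one_smul] at h4
  have hdy : x * y - y * x ∈ I := commutator_mem_ideal_right hy x
  have hw := star_mem_ideal hI hdy
  set w := x * y - y * x with hwdef
  refine mem_of_mul_star_mul_mem hJ ?_
  have h5 : w * star w * w = w * (x * (star w * y) - star w * y * x) -
      w * (x * star w - star w * x) * y := by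
    have : w * star w * w = w * star w * (x * y - y * x) := by rw [← hwdef]
    rw [this]
    noncomm_ring
  rw [h5]
  exact J.sub_mem (key _ (I.mul_mem_left _ _ hy)) (J.mul_mem_right _ _ (key _ hw))

/-- An element that is central and square-zero modulo a closed ideal belongs to the ideal. -/
theorem mem_of_sq_mem_of_commutator_mem {J : TwoSidedIdeal A} (hJ : IsClosed (J : Set A)) {w : A}
    (hc : ∀ a, w * a - a * w ∈ J) (hw : w * w ∈ J) : w ∈ J := by
  refine mem_of_mul_star_mul_mem hJ ?_
  have h : w * star w * w = (w * star w - star w * w) * w + star w * (w * w) := by noncomm_ring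
  rw [h]
  exact J.add_mem (J.mul_mem_right _ _ (hc _)) (J.mul_mem_left _ _ hw)

/-- If `[L, L]` is central modulo `J`, where `L = [I, I]`, then `I` is commutative modulo `J`. -/
theorem commutator_mem_of_commutator_commutator_mem {I J : TwoSidedIdeal A}
    (hI : IsClosed (I : Set A)) (hJ : IsClosed (J : Set A))
    (h : ∀ x ∈ commutatorSpan (I : Set A) (I : Set A),
      ∀ y ∈ commutatorSpan (I : Set A) (I : Set A), ∀ b : A,
        (x * y - y * x) * b - b * (x * y - y * x) ∈ J) {a b : A} (ha : a ∈ I) (hb : b ∈ I) :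
    a * b - b * a ∈ J := by
  have step : ∀ x ∈ commutatorSpan (I : Set A) (I : Set A), ∀ y ∈ I, x * y - y * x ∈ J := by
    intro x hx y hy
    refine commutator_mem_of_ad_sq_mem hI hJ (fun y hy => ?_) hy
    have hxI : x ∈ I := commutatorSpan_le_idealSubmodule I hx
    have hdL : x * y - y * x ∈ commutatorSpan (I : Set A) (I : Set A) :=
      mul_sub_mul_mem_commutatorSpan hxI hy
    have hxdL : x * (x * y - y * x) ∈ commutatorSpan (I : Set A) (I : Set A) := by
      have : x * (x * y - y * x) = x * (x * y) - x * y * x := by noncomm_ring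
      rw [this]
      exact mul_sub_mul_mem_commutatorSpan hxI (I.mul_mem_left _ _ hy)
    have hc := h x hx _ hdL
    have hcx := h x hx _ hxdL
    set d := x * y - y * x with hd
    refine mem_of_sq_mem_of_commutator_mem hJ hc ?_
    -- with `e = [x, d]`, both `e` and `x e = [x, x d]` are central modulo `J`, so `[x, d] e ∈ J`
    have e1 : (x * d - d * x) * (x * d - d * x) =
        ((x * (x * d) - x * d * x) * d - d * (x * (x * d) - x * d * x)) -
          x * ((x * d - d * x) * d - d * (x * d - d * x)) := by noncomm_ring
    rw [e1]
    exact J.sub_mem (hcx d) (J.mul_mem_left _ _ (hc d))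
  refine commutator_mem_of_ad_sq_mem hI hJ (fun y hy => ?_) hb
  have h1 := J.neg_mem (step _ (mul_sub_mul_mem_commutatorSpan ha hy) a ha)
  rwa [neg_sub] at h1

/-- Herstein's theorem for closed Lie ideals: a closed Lie ideal `L` contains `[J, A]`, where `J` is
the closed ideal generated by `[L, A]`. The normalizer `N(L) = {t | [t, A] ⊆ L}` is a subring and
contains the closed ideal generated by `[L, L]`; as `(ad x)² A ⊆ [L, L]` for `x ∈ L`, that ideal
already contains `[L, A]`. -/
theorem commutator_mem_of_mem_closedIdealSpan_commutator {L : Submodule ℂ A}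
    (hLc : IsClosed (L : Set A)) (hL : ∀ x ∈ L, ∀ a : A, x * a - a * x ∈ L) {y : A}
    (hy : y ∈ closedIdealSpan {z : A | ∃ x ∈ L, ∃ a : A, z = x * a - a * x}) (a : A) :
    y * a - a * y ∈ L := by
  -- the largest two-sided ideal contained in `N(L)`
  let T : TwoSidedIdeal A := TwoSidedIdeal.mk' {t | ∀ b c a : A, b * t * c * a - a * (b * t * c) ∈ L}
    (by intro b c a; simp)
    (by
      intro s t hs ht b c a
      have := L.add_mem (hs b c a) (ht b c a)
      convert this using 1
      noncomm_ring)
    (by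
      intro s hs b c a
      have := L.neg_mem (hs b c a)
      convert this using 1
      noncomm_ring)
    (by
      intro s t ht b c a
      have := ht (b * s) c a
      simpa only [mul_assoc] using this)
    (by
      intro s t hs b c a
      have := hs b (t * c) a
      simpa only [mul_assoc] using this)
  have hTc : IsClosed (T : Set A) := by
    have : (T : Set A) = ⋂ (b : A) (c : A) (a : A),
        (fun t => b * t * c * a - a * (b * t * c)) ⁻¹' (L : Set A) := by
      ext t
      simp [T]
    rw [this]
    exact isClosed_iInter fun b => isClosed_iInter fun c => isClosed_iInter fun a =>
      hLc.preimage (by fun_prop)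
  have hLL : ∀ x ∈ L, ∀ y ∈ L, x * y - y * x ∈ T := by
    intro x hx y hy
    -- `[x, y] c = [x, y c] - y [x, c]` lies in the subring `N(L)`
    have hN : ∀ c a : A, (x * y - y * x) * c * a - a * ((x * y - y * x) * c) ∈ L := by
      intro c a
      have e : (x * y - y * x) * c * a - a * ((x * y - y * x) * c) =
          ((x * (y * c) - y * c * x) * a - a * (x * (y * c) - y * c * x))
          - ((y * ((x * c - c * x) * a) - (x * c - c * x) * a * y)
            + ((x * c - c * x) * (a * y) - a * y * (x * c - c * x))) := by noncomm_ring
      rw [e]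
      exact L.sub_mem (hL _ (hL x hx _) a) (L.add_mem (hL y hy _) (hL _ (hL x hx c) _))
    change x * y - y * x ∈ TwoSidedIdeal.mk' _ _ _ _ _ _
    rw [TwoSidedIdeal.mem_mk']
    intro b c a
    -- for `t = [x, y]`, `b t c = t c b - [t c, b]`, and `N(L)` is a Lie ideal
    have h1 := L.neg_mem (hL _ (hN c b) a)
    have h2 := hN (c * b) a
    have := L.add_mem h1 h2
    convert this using 1
    noncomm_ring
  have hLA : ∀ x ∈ L, ∀ a : A, x * a - a * x ∈ T := by
    intro x hx a
    refine commutator_mem_of_ad_sq_mem (I := ⊤) (by simp) hTc (fun y _ => ?_)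
      (TwoSidedIdeal.mem_top A)
    exact hLL x hx _ (hL x hx y)
  have hyT : y ∈ T := by
    refine closedIdealSpan_le hTc ?_ hy
    rintro _ ⟨x, hx, a, rfl⟩
    exact hLA x hx a
  have := (TwoSidedIdeal.mem_mk' _ _ _ _ _ _ _).1 hyT 1 1 a
  simpa using this

/-- A unitary `u` for which all `u a u* - a` are central modulo a closed ideal `J` is itself
central modulo `J`. -/
theorem commutator_mem_of_conj_sub_central {J : TwoSidedIdeal A} (hJ : IsClosed (J : Set A))
    {u : A} (hu : u ∈ unitary A)
    (h : ∀ a b : A, (u * a * star u - a) * b - b * (u * a * star u - a) ∈ J) (a : A) :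
    u * a - a * u ∈ J := by
  have huu : star u * u = 1 := Unitary.star_mul_self_of_mem hu
  set z := u * a * star u - a with hz
  have hzu : z * u = u * a - a * u := by
    rw [hz, sub_mul, mul_assoc, huu, mul_one]
  rw [← hzu]
  refine J.mul_mem_right _ _ (mem_of_sq_mem_of_commutator_mem hJ (h a) ?_)
  -- commuting `Ad u (a u) - a u` with `a` yields `z [u, a] ∈ J`, that is `z z u ∈ J`
  have e1 : u * (a * u) * star u - a * u = z * u := by
    rw [hzu]
    have : u * star u = 1 := Unitary.mul_star_self_of_mem hu
    simp only [mul_assoc, this, mul_one]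
  have h1 := h (a * u) a
  rw [e1] at h1
  have e2 : z * z * u = (z * u * a - a * (z * u)) - (z * a - a * z) * u := by
    have : z * z * u = z * (u * a) - z * (a * u) := by rw [mul_assoc, hzu, mul_sub]
    rw [this]
    noncomm_ring
  have h3 : z * z * u ∈ J := by
    rw [e2]
    exact J.sub_mem h1 (J.mul_mem_right _ _ (h a a))
  have h4 := J.mul_mem_right _ (star u) h3
  rwa [mul_assoc (z * z), Unitary.mul_star_self_of_mem hu, mul_one] at h4

end Herstein

/-! ### Exponential unitaries and the Lie algebra of a closed subgroup -/

section Calculus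

variable {E : Type*} [NormedAddCommGroup E] [NormedSpace ℂ E]

theorem deriv_mem_of_forall_sub_mem {M : Submodule ℂ E} (hM : IsClosed (M : Set E)) {g : ℝ → E}
    {g' : E} (hg : HasDerivAt g g' 0) (h : ∀ s, g s - g 0 ∈ M) : g' ∈ M := by
  refine hM.mem_of_tendsto hg.tendsto_slope (Eventually.of_forall fun s => ?_)
  have := (M.restrictScalars ℝ).smul_mem (s - 0)⁻¹ (h s)
  simpa [slope] using this

/-- A curve with velocities in a closed subspace `M` stays in one coset of `M`: its image in the
quotient by `M` has derivative zero. -/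
theorem sub_mem_of_forall_deriv_mem {M : Submodule ℂ E} (hM : IsClosed (M : Set E)) {g g' : ℝ → E}
    (hg : ∀ s, HasDerivAt g (g' s) s) (h : ∀ s, g' s ∈ M) (s t : ℝ) : g s - g t ∈ M := by
  have : IsClosed (M.toAddSubgroup : Set E) := hM
  have hd : ∀ s, HasDerivAt (fun s => M.mkQL (g s)) 0 s := by
    intro s
    have h1 := ((M.mkQL.restrictScalars ℝ).hasFDerivAt (x := g s)).comp_hasDerivAt s (hg s)
    have h2 : M.mkQL.restrictScalars ℝ (g' s) = 0 := by
      simpa using (Submodule.Quotient.mk_eq_zero M).2 (h s)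
    rw [h2] at h1
    exact h1
  have h3 := is_const_of_deriv_eq_zero (fun s => (hd s).differentiableAt)
    (fun s => (hd s).deriv) s t
  exact (Submodule.Quotient.eq M).1 h3

end Calculus

section Exponential

variable {A : Type*} [CStarAlgebra A]

theorem expUnitary_smul_coe (a : selfAdjoint A) (t : ℝ) :
    (expUnitary (t • a) : A) = NormedSpace.exp (t • (I • (a : A))) := by
  rw [expUnitary_coe, selfAdjoint.val_smul, smul_comm]

theorem expUnitary_neg (a : selfAdjoint A) : expUnitary (-a) = (expUnitary a)⁻¹ := by
  refine eq_inv_of_mul_eq_one_left ?_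
  rw [← Commute.expUnitary_add (by simp), neg_add_cancel, expUnitary_zero]

theorem expUnitary_nsmul (a : selfAdjoint A) (n : ℕ) : expUnitary (n • a) = expUnitary a ^ n := by
  induction n with
  | zero => simp
  | succ n ih =>
    rw [succ_nsmul, Commute.expUnitary_add, ih, pow_succ]
    rw [AddSubgroup.coe_nsmul]
    exact (Commute.refl _).smul_left n

theorem inv_expUnitary_coe (a : selfAdjoint A) :
    (((expUnitary a)⁻¹ : unitary A) : A) = expUnitary (-a) := by
  rw [expUnitary_neg]

theorem hasDerivAt_expUnitary (a : selfAdjoint A) (t : ℝ) :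
    HasDerivAt (fun t : ℝ => (expUnitary (t • a) : A))
      (I • (a : A) * (expUnitary (t • a) : A)) t := by
  simp only [expUnitary_smul_coe]
  exact hasDerivAt_exp_smul_const' (𝕂 := ℝ) (I • (a : A)) t

theorem hasDerivAt_expUnitary' (a : selfAdjoint A) (t : ℝ) :
    HasDerivAt (fun t : ℝ => (expUnitary (t • a) : A))
      ((expUnitary (t • a) : A) * (I • (a : A))) t := by
  simp only [expUnitary_smul_coe]
  exact hasDerivAt_exp_smul_const (𝕂 := ℝ) (I • (a : A)) t

theorem hasDerivAt_inv_expUnitary (a : selfAdjoint A) (t : ℝ) :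
    HasDerivAt (fun t : ℝ => (((expUnitary (t • a))⁻¹ : unitary A) : A))
      (-((((expUnitary (t • a))⁻¹ : unitary A) : A) * (I • (a : A)))) t := by
  have h := hasDerivAt_expUnitary' (-a) t
  simpa only [smul_neg, inv_expUnitary_coe, AddSubgroup.coe_neg, mul_neg] using h

/-- The conjugate `u a u*` of a selfadjoint element by a unitary. -/
def unitaryConj (u : unitary A) (a : selfAdjoint A) : selfAdjoint A :=
  ⟨u * a * ((u⁻¹ : unitary A) : A), by
    have := a.2.conjugate (u : A)
    exact this⟩

theorem unitaryConj_coe (u : unitary A) (a : selfAdjoint A) :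
    (unitaryConj u a : A) = u * a * ((u⁻¹ : unitary A) : A) := rfl

theorem unitaryConj_smul (u : unitary A) (t : ℝ) (a : selfAdjoint A) :
    unitaryConj u (t • a) = t • unitaryConj u a := by
  ext
  simp [unitaryConj_coe]

theorem expUnitary_unitaryConj (u : unitary A) (a : selfAdjoint A) :
    expUnitary (unitaryConj u a) = u * expUnitary a * u⁻¹ := by
  ext
  let +nondep : NormedAlgebra ℚ A := .restrictScalars ℚ ℂ A
  have h := NormedSpace.exp_units_conj (Unitary.toUnits u) (I • (a : A))
  rw [expUnitary_coe, unitaryConj_coe]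
  push_cast
  rw [expUnitary_coe]
  have e : I • ((u : A) * (a : A) * star (u : A)) = (u : A) * (I • (a : A)) * star (u : A) := by
    simp
  simpa [e] using h

theorem hasDerivAt_conj_expUnitary (a : selfAdjoint A) (x : A) (t : ℝ) :
    HasDerivAt
      (fun t : ℝ => (expUnitary (t • a) : A) * x * (((expUnitary (t • a))⁻¹ : unitary A) : A))
      (I • ((a : A) * ((expUnitary (t • a) : A) * x * (((expUnitary (t • a))⁻¹ : unitary A) : A)) -
        (expUnitary (t • a) : A) * x * (((expUnitary (t • a))⁻¹ : unitary A) : A) * a)) t := by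
  have h := ((hasDerivAt_expUnitary a t).mul_const x).mul (hasDerivAt_inv_expUnitary a t)
  refine h.congr_deriv ?_
  simp only [smul_add, smul_neg, smul_mul_assoc, mul_smul_comm, mul_assoc, mul_neg, sub_eq_add_neg]

/-- Multiplication by unitaries is isometric, so a telescoping sum gives this bound. -/
theorem norm_pow_sub_pow_le (u v : unitary A) (n : ℕ) :
    ‖((u ^ n : unitary A) : A) - ((v ^ n : unitary A) : A)‖ ≤ n * ‖(u : A) - v‖ := by
  induction n with
  | zero => simp
  | succ n ih =>
    have e : ((u ^ (n + 1) : unitary A) : A) - ((v ^ (n + 1) : unitary A) : A) =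
        (((u ^ n : unitary A) : A) - ((v ^ n : unitary A) : A)) * (u : A) +
          ((v ^ n : unitary A) : A) * ((u : A) - v) := by
      rw [pow_succ, pow_succ]
      push_cast
      noncomm_ring
    rw [e]
    refine (norm_add_le _ _).trans ?_
    rw [CStarRing.norm_mul_coe_unitary, CStarRing.norm_coe_unitary_mul]
    push_cast at ih ⊢
    linarith

/-- A Lie–Trotter product formula: if `f` is a curve of unitaries with `f 0 = 1` and `f' 0 = i a`,
then `f (1 / n) ^ n` tends to `exp (i a)`. -/
theorem tendsto_pow_expUnitary {f : ℝ → unitary A} {a : selfAdjoint A} (hf0 : f 0 = 1)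
    (hf : HasDerivAt (fun t => (f t : A)) (I • (a : A)) 0) :
    Tendsto (fun n : ℕ => f (n : ℝ)⁻¹ ^ n) atTop (𝓝 (expUnitary a)) := by
  rw [tendsto_subtype_rng, tendsto_iff_norm_sub_tendsto_zero]
  have hd : HasDerivAt (fun t => (f t : A) - (expUnitary (t • a) : A)) 0 0 := by
    refine (hf.sub (hasDerivAt_expUnitary a 0)).congr_deriv ?_
    rw [zero_smul, expUnitary_zero, OneMemClass.coe_one, mul_one, sub_self]
  have hs := (hasDerivAt_iff_tendsto_slope_zero.1 hd).norm
  have hn : Tendsto (fun n : ℕ => (n : ℝ)⁻¹) atTop (𝓝[≠] 0) :=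
    tendsto_nhdsWithin_of_tendsto_nhds_of_eventually_within _ tendsto_inv_atTop_nhds_zero_nat
      ((eventually_gt_atTop 0).mono fun n hn => by
        simpa using hn.ne')
  have hs' := hs.comp hn
  rw [norm_zero] at hs'
  refine squeeze_zero_norm' ?_ hs'
  filter_upwards [eventually_gt_atTop 0] with n hn
  have hn' : (n : ℝ) ≠ 0 := by exact_mod_cast hn.ne'
  have e : expUnitary a = expUnitary ((n : ℝ)⁻¹ • a) ^ n := by
    rw [← expUnitary_nsmul, ← Nat.cast_smul_eq_nsmul ℝ, smul_smul, mul_inv_cancel₀ hn', one_smul]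
  rw [norm_norm, e]
  refine (norm_pow_sub_pow_le _ _ n).trans (le_of_eq ?_)
  simp [hf0, norm_smul]

theorem tendsto_pow_expUnitary_smul {f : ℝ → unitary A} {a : selfAdjoint A} (hf0 : f 0 = 1)
    (hf : HasDerivAt (fun t => (f t : A)) (I • (a : A)) 0) (t : ℝ) :
    Tendsto (fun n : ℕ => f (t * (n : ℝ)⁻¹) ^ n) atTop (𝓝 (expUnitary (t • a))) := by
  refine tendsto_pow_expUnitary (f := fun s => f (t * s)) (by simpa using hf0) ?_
  have h1 : HasDerivAt (fun s : ℝ => t * s) t 0 := by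
    simpa using (hasDerivAt_id (0 : ℝ)).const_mul t
  have h2 : HasDerivAt (fun s => (f s : A)) (I • (a : A)) (t * 0) := by simpa using hf
  have h3 := h2.scomp (0 : ℝ) h1
  rw [selfAdjoint.val_smul, smul_comm]
  exact h3

/-- The velocity of a curve in a closed subgroup generates a one-parameter group in the subgroup. -/
theorem expUnitary_mem_of_hasDerivAt {H : Subgroup (unitary A)} (hH : IsClosed (H : Set (unitary A)))
    {f : ℝ → unitary A} {a : selfAdjoint A} (hfH : ∀ t, f t ∈ H) (hf0 : f 0 = 1)
    (hf : HasDerivAt (fun t => (f t : A)) (I • (a : A)) 0) (t : ℝ) : expUnitary (t • a) ∈ H :=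
  hH.mem_of_tendsto (tendsto_pow_expUnitary_smul hf0 hf t)
    (Eventually.of_forall fun n => H.pow_mem (hfH _) n)

theorem hasDerivAt_expUnitary_mul_zero (a b : selfAdjoint A) :
    HasDerivAt (fun t : ℝ => ((expUnitary (t • a) * expUnitary (t • b) : unitary A) : A))
      (I • ((a + b : selfAdjoint A) : A)) 0 := by
  refine ((hasDerivAt_expUnitary a 0).mul (hasDerivAt_expUnitary b 0)).congr_deriv ?_
  simp only [zero_smul, expUnitary_zero, OneMemClass.coe_one, mul_one, one_mul,
    AddSubgroup.coe_add, smul_add]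

/-- The Lie algebra of a closed subgroup `H` of the unitary group, as the real subspace of those
selfadjoint `a` for which all `exp (i t a)` belong to `H`. -/
def realLie (H : Subgroup (unitary A)) (hH : IsClosed (H : Set (unitary A))) :
    Submodule ℝ (selfAdjoint A) where
  carrier := {a | ∀ t : ℝ, expUnitary (t • a) ∈ H}
  zero_mem' t := by simp [H.one_mem]
  add_mem' {a b} ha hb := expUnitary_mem_of_hasDerivAt hH (fun t => H.mul_mem (ha t) (hb t))
    (by simp) (hasDerivAt_expUnitary_mul_zero a b)
  smul_mem' c a ha t := by simpa only [smul_smul] using ha (t * c)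

/-- The complexification `{x | Re x, Im x ∈ realLie H}` of the Lie algebra of a closed subgroup. -/
def complexLie (H : Subgroup (unitary A)) (hH : IsClosed (H : Set (unitary A))) :
    Submodule ℂ A where
  carrier := {x | realPart x ∈ realLie H hH ∧ imaginaryPart x ∈ realLie H hH}
  zero_mem' := by simp
  add_mem' {x y} hx hy := by
    simpa using ⟨Submodule.add_mem _ hx.1 hy.1, Submodule.add_mem _ hx.2 hy.2⟩
  smul_mem' c x hx := by
    change realPart (c • x) ∈ _ ∧ imaginaryPart (c • x) ∈ _
    rw [realPart_smul, imaginaryPart_smul]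
    exact ⟨Submodule.sub_mem _ (Submodule.smul_mem _ _ hx.1) (Submodule.smul_mem _ _ hx.2),
      Submodule.add_mem _ (Submodule.smul_mem _ _ hx.2) (Submodule.smul_mem _ _ hx.1)⟩

variable {H : Subgroup (unitary A)} (hH : IsClosed (H : Set (unitary A)))

theorem mem_complexLie_iff {x : A} :
    x ∈ complexLie H hH ↔
      (realPart x : A) ∈ complexLie H hH ∧ (imaginaryPart x : A) ∈ complexLie H hH := by
  have h : ∀ a : selfAdjoint A, (a : A) ∈ complexLie H hH ↔ a ∈ realLie H hH := fun a => by
    change realPart (a : A) ∈ _ ∧ imaginaryPart (a : A) ∈ _ ↔ _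
    simp [selfAdjoint.realPart_coe]
  rw [h, h]
  rfl

theorem coe_mem_complexLie_iff {a : selfAdjoint A} :
    (a : A) ∈ complexLie H hH ↔ ∀ t : ℝ, expUnitary (t • a) ∈ H := by
  change realPart (a : A) ∈ realLie H hH ∧ imaginaryPart (a : A) ∈ realLie H hH ↔ a ∈ realLie H hH
  simp [selfAdjoint.realPart_coe]

theorem isClosed_complexLie : IsClosed (complexLie H hH : Set A) := by
  have h1 : IsClosed (realLie H hH : Set (selfAdjoint A)) := by
    have : (realLie H hH : Set (selfAdjoint A)) =
        ⋂ t : ℝ, (fun a : selfAdjoint A => expUnitary (t • a)) ⁻¹' (H : Set (unitary A)) := by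
      ext a
      simp [realLie]
    rw [this]
    exact isClosed_iInter fun t => hH.preimage (by fun_prop)
  have hre : Continuous fun x : A => realPart x := by
    refine continuous_induced_rng.2 ?_
    simp only [Function.comp_def, realPart_apply_coe]
    fun_prop
  have him : Continuous fun x : A => imaginaryPart x := by
    refine continuous_induced_rng.2 ?_
    simp only [Function.comp_def, imaginaryPart_apply_coe]
    fun_prop
  exact (h1.preimage hre).inter (h1.preimage him)

/-- The group commutators of `u` with a one-parameter group `exp (i t a)` have velocity
`u a u* - a`. -/
theorem unitaryConj_sub_mem_complexLie {u : unitary A} {a : selfAdjoint A}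
    (h : ∀ t : ℝ, ⁅u, expUnitary (t • a)⁆ ∈ H) :
    (unitaryConj u a : A) - a ∈ complexLie H hH := by
  have e : (unitaryConj u a : A) - a = ((unitaryConj u a + -a : selfAdjoint A) : A) := by
    simp [sub_eq_add_neg]
  rw [e, coe_mem_complexLie_iff]
  refine expUnitary_mem_of_hasDerivAt hH (fun t => ?_) (by simp)
    (hasDerivAt_expUnitary_mul_zero (unitaryConj u a) (-a))
  have := h t
  rwa [commutatorElement_def, ← expUnitary_unitaryConj, unitaryConj_smul, ← expUnitary_neg,
    ← smul_neg] at this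

/-- If the group commutators of two one-parameter groups lie in `H`, then the commutator of their
generators lies in the Lie algebra of `H`. -/
theorem commutator_mem_complexLie {a b : selfAdjoint A}
    (h : ∀ s t : ℝ, ⁅expUnitary (s • a), expUnitary (t • b)⁆ ∈ H) :
    (a : A) * b - b * a ∈ complexLie H hH := by
  have hd := hasDerivAt_conj_expUnitary a (b : A) 0
  have h1 := deriv_mem_of_forall_sub_mem (isClosed_complexLie hH) hd (fun s => by
    simpa [unitaryConj_coe] using unitaryConj_sub_mem_complexLie hH (h s))
  simp only [zero_smul, expUnitary_zero, OneMemClass.coe_one, inv_one, mul_one, one_mul] at h1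
  have h2 := (complexLie H hH).smul_mem (-I) h1
  simpa [smul_smul] using h2

theorem complexLie_le {N : Submodule ℂ A}
    (h : ∀ a : selfAdjoint A, (∀ t : ℝ, expUnitary (t • a) ∈ H) → (a : A) ∈ N) :
    complexLie H hH ≤ N := by
  intro x hx
  rw [← realPart_add_I_smul_imaginaryPart x]
  rw [mem_complexLie_iff, coe_mem_complexLie_iff, coe_mem_complexLie_iff] at hx
  exact N.add_mem (h _ hx.1) (N.smul_mem _ (h _ hx.2))

theorem mem_of_forall_selfAdjoint_mem {N : Submodule ℂ A} (h : ∀ a : selfAdjoint A, (a : A) ∈ N)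
    (x : A) : x ∈ N := by
  rw [← realPart_add_I_smul_imaginaryPart x]
  exact N.add_mem (h _) (N.smul_mem _ (h _))

/-- If `c - b` belongs to the Lie algebra of `H`, and `H` is normalized by the one-parameter group
of `b`, then `exp (i c)` and `exp (i b)` agree modulo `H`. -/
theorem expUnitary_mul_inv_mem {b c : selfAdjoint A}
    (hn : ∀ t : ℝ, ∀ h ∈ H, expUnitary (t • b) * h * (expUnitary (t • b))⁻¹ ∈ H)
    (hbc : (c : A) - b ∈ complexLie H hH) : expUnitary c * (expUnitary b)⁻¹ ∈ H := by
  have hbc' : ∀ t : ℝ, expUnitary (t • (c - b)) ∈ H := by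
    rwa [← coe_mem_complexLie_iff hH]
  have hd := hasDerivAt_expUnitary_mul_zero b (c - b)
  rw [add_sub_cancel] at hd
  have ht := (tendsto_pow_expUnitary (f := fun t : ℝ => expUnitary (t • b) * expUnitary (t • (c - b)))
    (by simp) hd).mul_const (expUnitary b)⁻¹
  refine hH.mem_of_tendsto ht ((eventually_gt_atTop 0).mono fun n hn0 => ?_)
  have hn' : (n : ℝ) ≠ 0 := by exact_mod_cast hn0.ne'
  have e : expUnitary b = expUnitary ((n : ℝ)⁻¹ • b) ^ n := by
    rw [← expUnitary_nsmul, ← Nat.cast_smul_eq_nsmul ℝ, smul_smul, mul_inv_cancel₀ hn', one_smul]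
  rw [e]
  -- `(g h)ᵏ g⁻ᵏ ∈ H` whenever `h ∈ H` and `g` normalizes `H`
  have key : ∀ (g h : unitary A), (∀ x ∈ H, g * x * g⁻¹ ∈ H) → h ∈ H →
      ∀ k : ℕ, (g * h) ^ k * (g ^ k)⁻¹ ∈ H := by
    intro g h hg hh k
    induction k with
    | zero => simp [H.one_mem]
    | succ k ih =>
      have : (g * h) ^ (k + 1) * (g ^ (k + 1))⁻¹ =
          g * (h * ((g * h) ^ k * (g ^ k)⁻¹)) * g⁻¹ := by
        rw [pow_succ' (g * h), pow_succ g k]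
        rw [← pow_succ, pow_succ' g k]
        group
      rw [this]
      exact hg _ (H.mul_mem hh ih)
  exact key _ _ (hn _) (hbc' _) n

/-- If a closed subspace `M` contains `[a, A]`, then it contains `e^{ia} x e^{-ia} - x` for all
`x`. -/
theorem expUnitary_conj_sub_mem {M : Submodule ℂ A} (hM : IsClosed (M : Set A)) {a : selfAdjoint A}
    (h : ∀ x : A, (a : A) * x - x * a ∈ M) (x : A) :
    (expUnitary a : A) * x * (((expUnitary a)⁻¹ : unitary A) : A) - x ∈ M := by
  have := sub_mem_of_forall_deriv_mem hM (hasDerivAt_conj_expUnitary a x)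
    (fun s => M.smul_mem _ (h _)) 1 0
  simpa using this

end Exponential

/-! ### Commutators in topological groups -/

section TopologicalGroups

variable {G : Type*} [Group G]

/-- Commutators of two subgroups lie in `H` as soon as those of generators do, provided that a group
`N` containing the generators normalizes `H`. -/
theorem commutator_closure_le {S T : Set G} {H N : Subgroup G}
    (hN : ∀ g ∈ N, ∀ h ∈ H, g * h * g⁻¹ ∈ H) (hS : S ⊆ N) (hT : T ⊆ N)
    (h : ∀ s ∈ S, ∀ t ∈ T, ⁅s, t⁆ ∈ H) :
    ⁅Subgroup.closure S, Subgroup.closure T⁆ ≤ H := by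
  have hS' : Subgroup.closure S ≤ N := (Subgroup.closure_le N).2 hS
  have hT' : Subgroup.closure T ≤ N := (Subgroup.closure_le N).2 hT
  have hsymm : ∀ a b : G, ⁅a, b⁆ ∈ H → ⁅b, a⁆ ∈ H := fun a b hab => by
    rw [← commutatorElement_inv]; exact H.inv_mem hab
  have hmul : ∀ a ∈ N, ∀ b c : G, ⁅a, c⁆ ∈ H → ⁅b, c⁆ ∈ H → ⁅a * b, c⁆ ∈ H := fun a ha b c h1 h2 => by
    have : ⁅a * b, c⁆ = a * ⁅b, c⁆ * a⁻¹ * ⁅a, c⁆ := by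
      simp only [commutatorElement_def]; group
    rw [this]
    exact H.mul_mem (hN a ha _ h2) h1
  have hinv : ∀ a ∈ N, ∀ c : G, ⁅a, c⁆ ∈ H → ⁅a⁻¹, c⁆ ∈ H := fun a ha c h1 => by
    have : ⁅a⁻¹, c⁆ = a⁻¹ * ⁅c, a⁆ * a⁻¹⁻¹ := by
      simp only [commutatorElement_def]; group
    rw [this]
    exact hN _ (N.inv_mem ha) _ (hsymm _ _ h1)
  have h1 : ∀ g ∈ Subgroup.closure S, ∀ t ∈ T, ⁅g, t⁆ ∈ H := by
    intro g hg t ht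
    induction hg using Subgroup.closure_induction with
    | mem x hx => exact h x hx t ht
    | one => simp
    | mul x y hx hy ihx ihy => exact hmul x (hS' hx) y t ihx ihy
    | inv x hx ih => exact hinv x (hS' hx) t ih
  rw [Subgroup.commutator_le]
  intro g hg k hk
  refine hsymm _ _ ?_
  induction hk using Subgroup.closure_induction with
  | mem x hx => exact hsymm _ _ (h1 g hg x hx)
  | one => simp
  | mul x y hx hy ihx ihy => exact hmul x (hT' hx) y g ihx ihy
  | inv x hx ih => exact hinv x (hT' hx) g ih

variable [TopologicalSpace G] [IsTopologicalGroup G]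

theorem isClosed_closedCommutator (H : Subgroup G) : IsClosed (closedCommutator H : Set G) :=
  Subgroup.isClosed_topologicalClosure _

theorem closedCommutator_le {H K : Subgroup G} (hK : IsClosed (K : Set G)) (h : ⁅H, H⁆ ≤ K) :
    closedCommutator H ≤ K :=
  Subgroup.topologicalClosure_minimal _ h hK

theorem commutator_le_closedCommutator (H : Subgroup G) : ⁅H, H⁆ ≤ closedCommutator H :=
  Subgroup.le_topologicalClosure _

theorem conj_mem_closedCommutator {H : Subgroup G} {u : G} (h : ∀ x ∈ H, u * x * u⁻¹ ∈ H) :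
    ∀ x ∈ closedCommutator H, u * x * u⁻¹ ∈ closedCommutator H := by
  have h1 : Set.MapsTo (fun x => u * x * u⁻¹) (⁅H, H⁆ : Subgroup G) (⁅H, H⁆ : Subgroup G) := by
    intro x hx
    have h2 : (⁅H, H⁆ : Subgroup G).map (MulAut.conj u).toMonoidHom ≤ ⁅H, H⁆ := by
      rw [Subgroup.map_commutator]
      have h3 : H.map (MulAut.conj u).toMonoidHom ≤ H := by
        rintro _ ⟨y, hy, rfl⟩
        exact h y hy
      exact Subgroup.commutator_mono h3 h3
    exact h2 ⟨x, hx, rfl⟩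
  exact fun x hx => h1.closure (by fun_prop) hx

/-- Forming the closed commutator subgroup commutes with the inclusion of a closed subgroup. -/
theorem map_closedCommutator {U : Subgroup G} (hU : IsClosed (U : Set G)) (H : Subgroup U) :
    (closedCommutator H).map U.subtype = closedCommutator (H.map U.subtype) := by
  have h1 : ((⁅H, H⁆ : Subgroup U).map U.subtype) = ⁅H.map U.subtype, H.map U.subtype⁆ :=
    Subgroup.map_commutator _ _ _
  apply SetLike.coe_injective
  change Subtype.val '' closure ((⁅H, H⁆ : Subgroup U) : Set U) =
    closure ((⁅H.map U.subtype, H.map U.subtype⁆ : Subgroup G) : Set G)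
  rw [← h1]
  exact (hU.isClosedEmbedding_subtypeVal.closure_image_eq _).symm

end TopologicalGroups

/-! ### The identity components are generated by exponentials -/

section Components

variable {A : Type*} [CStarAlgebra A]

theorem isClosed_idealUnitary {I : TwoSidedIdeal A} (hI : IsClosed (I : Set A)) :
    IsClosed (idealUnitary I : Set (unitary A)) :=
  hI.preimage (continuous_subtype_val.sub continuous_const)

theorem connectedIdealUnitary_le_idealUnitary (I : TwoSidedIdeal A) :
    connectedIdealUnitary I ≤ idealUnitary I := by
  rintro _ ⟨u, -, rfl⟩
  exact u.2

theorem connectedIdealUnitary_mono {I J : TwoSidedIdeal A} (h : I ≤ J) :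
    connectedIdealUnitary I ≤ connectedIdealUnitary J := by
  have hle : idealUnitary I ≤ idealUnitary J := fun u hu => h hu
  rintro _ ⟨u, hu, rfl⟩
  have hc : Continuous (Subgroup.inclusion hle) := continuous_inclusion hle
  exact ⟨Subgroup.inclusion hle u, hc.image_connectedComponent_subset 1 ⟨u, hu, rfl⟩, rfl⟩

theorem CU_mono {I J : TwoSidedIdeal A} (h : I ≤ J) : CU I ≤ CU J :=
  closedCommutator_le (isClosed_closedCommutator _)
    ((Subgroup.commutator_mono (connectedIdealUnitary_mono h) (connectedIdealUnitary_mono h)).trans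
      (commutator_le_closedCommutator _))

/-- `U_I` contains every connected family in `U(I)` that passes through `1`. -/
theorem mem_connectedIdealUnitary_of_continuous {X : Type*} [TopologicalSpace X]
    [PreconnectedSpace X] {I : TwoSidedIdeal A} {f : X → unitary A} (hf : Continuous f)
    (hfI : ∀ x, f x ∈ idealUnitary I) {x₀ : X} (h0 : f x₀ = 1) (x : X) :
    f x ∈ connectedIdealUnitary I := by
  let g : X → idealUnitary I := fun x => ⟨f x, hfI x⟩
  have hg : Continuous g := hf.subtype_mk hfI
  have h1 : g x₀ = 1 := Subtype.ext h0
  have h2 := hg.image_connectedComponent_subset x₀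
  rw [PreconnectedSpace.connectedComponent_eq_univ, h1] at h2
  exact ⟨g x, h2 ⟨x, trivial, rfl⟩, rfl⟩

theorem expUnitary_mem_idealUnitary {I : TwoSidedIdeal A} (hI : IsClosed (I : Set A))
    {a : selfAdjoint A} (ha : (a : A) ∈ I) : expUnitary a ∈ idealUnitary I := by
  have := sub_mem_of_forall_deriv_mem (M := idealSubmodule I) hI (hasDerivAt_expUnitary a)
    (fun t => I.mul_mem_right _ _ (smul_mem_ideal I Complex.I ha)) 1 0
  simp only [one_smul, zero_smul, expUnitary_zero, OneMemClass.coe_one] at this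
  exact this

theorem smul_coe_mem_ideal (I : TwoSidedIdeal A) {a : selfAdjoint A} (ha : (a : A) ∈ I) (t : ℝ) :
    ((t • a : selfAdjoint A) : A) ∈ I := by
  have := smul_mem_ideal I (t : ℂ) ha
  rwa [Complex.coe_smul] at this

theorem expUnitary_mem_connectedIdealUnitary {I : TwoSidedIdeal A} (hI : IsClosed (I : Set A))
    {a : selfAdjoint A} (ha : (a : A) ∈ I) : expUnitary a ∈ connectedIdealUnitary I := by
  have := mem_connectedIdealUnitary_of_continuous (I := I)
    (f := fun t : ℝ => expUnitary (t • a)) (by fun_prop)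
    (fun t => expUnitary_mem_idealUnitary hI (smul_coe_mem_ideal I ha t)) (x₀ := 0) (by simp) 1
  simpa using this

/-- A closed ideal of a C*-algebra, as a non-unital *-subalgebra. -/
def idealStarSubalgebra (I : TwoSidedIdeal A) (hI : IsClosed (I : Set A)) :
    NonUnitalStarSubalgebra ℂ A where
  __ := idealSubmodule I
  mul_mem' {_ y} hx _ := I.mul_mem_right _ y hx
  star_mem' hx := star_mem_ideal hI hx

/-- The logarithm of a unitary in `1 + I` that is close to `1` lies in `I`, as it is a function
vanishing at `0` of the normal element `u - 1 ∈ I`. -/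
theorem argSelfAdjoint_mem_ideal {I : TwoSidedIdeal A} (hI : IsClosed (I : Set A))
    {u : unitary A} (huI : u ∈ idealUnitary I) (hu : ‖(u - 1 : A)‖ < 2) :
    (Unitary.argSelfAdjoint u : A) ∈ I := by
  have harg : ContinuousOn (fun z : ℂ => (arg z : ℂ)) (spectrum ℂ (u : A)) :=
    continuous_ofReal.comp_continuousOn (continuousOn_arg.mono
      ((Unitary.spectrum_subset_slitPlane_iff_norm_lt_two u.2).mpr hu))
  have hu1 : cfc (fun z : ℂ => z - 1) (u : A) = u - 1 := by
    rw [cfc_sub (fun z : ℂ => z) (fun _ : ℂ => (1 : ℂ)) (u : A), cfc_id' ℂ (u : A),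
      cfc_const_one ℂ (u : A)]
  have him : ContinuousOn (fun z : ℂ => (arg (z + 1) : ℂ))
      ((fun z : ℂ => z - 1) '' spectrum ℂ (u : A)) := by
    refine harg.comp (f := fun z : ℂ => z + 1) (by fun_prop) ?_
    rintro _ ⟨z, hz, rfl⟩
    simpa using hz
  have h1 : (Unitary.argSelfAdjoint u : A) =
      cfc (fun z : ℂ => (arg (z + 1) : ℂ)) ((u : A) - 1) := by
    rw [← hu1, ← cfc_comp' (fun z : ℂ => (arg (z + 1) : ℂ)) (fun z : ℂ => z - 1) (u : A) him]
    simp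
  have hnorm : IsStarNormal ((u : A) - 1) := by
    rw [← hu1]
    exact cfc_predicate _ _
  have him' : ContinuousOn (fun z : ℂ => (arg (z + 1) : ℂ)) (quasispectrum ℂ ((u : A) - 1)) := by
    refine continuous_ofReal.comp_continuousOn
      (continuousOn_arg.comp (f := fun z : ℂ => z + 1) (by fun_prop) ?_)
    rw [← hu1, quasispectrum_eq_spectrum_union_zero, cfc_map_spectrum _ _]
    rintro _ (⟨z, hz, rfl⟩ | rfl)
    · simpa using (Unitary.spectrum_subset_slitPlane_iff_norm_lt_two u.2).mpr hu hz
    · simp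
  rw [h1, ← cfcₙ_eq_cfc him' (by simp)]
  exact NonUnitalStarAlgebra.elemental.le_of_mem (s := idealStarSubalgebra I hI) hI
    (x := (u : A) - 1) huI (cfcₙ_mem_elemental _ _)

theorem connectedIdealUnitary_eq_closure {I : TwoSidedIdeal A} (hI : IsClosed (I : Set A)) :
    connectedIdealUnitary I =
      Subgroup.closure {u | ∃ a : selfAdjoint A, (a : A) ∈ I ∧ expUnitary a = u} := by
  refine le_antisymm ?_ ((Subgroup.closure_le _).2 ?_)
  · set S := Subgroup.closure {u | ∃ a : selfAdjoint A, (a : A) ∈ I ∧ expUnitary a = u}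
    -- near `1` every element of `U(I)` is an exponential, so these generate an open subgroup
    have hopen : IsOpen (S.subgroupOf (idealUnitary I) : Set (idealUnitary I)) := by
      refine Subgroup.isOpen_of_mem_nhds _ (g := 1) ?_
      have hcont : Continuous fun u : idealUnitary I => ‖((u : unitary A) : A) - 1‖ := by fun_prop
      have hnhds : {u : idealUnitary I | ‖((u : unitary A) : A) - 1‖ < 2} ∈ 𝓝 1 :=
        (isOpen_lt hcont continuous_const).mem_nhds (by simp)
      filter_upwards [hnhds] with u hu
      refine Subgroup.subset_closure ⟨_, argSelfAdjoint_mem_ideal hI u.2 hu, ?_⟩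
      exact expUnitary_argSelfAdjoint hu
    have hclopen : IsClopen (S.subgroupOf (idealUnitary I) : Set (idealUnitary I)) :=
      ⟨Subgroup.isClosed_of_isOpen _ hopen, hopen⟩
    rintro _ ⟨u, hu, rfl⟩
    exact hclopen.connectedComponent_subset (one_mem _) hu
  · rintro _ ⟨a, ha, rfl⟩
    exact expUnitary_mem_connectedIdealUnitary hI ha

theorem connectedIdealUnitary_top : connectedIdealUnitary (⊤ : TwoSidedIdeal A) =
    connectedUnitary A := by
  refine le_antisymm (connectedIdealUnitary_le _) fun u hu => ?_
  have hu' : u ∈ pathComponent (1 : unitary A) := by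
    rw [pathComponent_eq_connectedComponent]
    exact hu
  obtain ⟨l, rfl⟩ := Unitary.mem_pathComponentOne_iff.1 hu'
  refine Subgroup.list_prod_mem _ fun v hv => ?_
  obtain ⟨a, -, rfl⟩ := List.mem_map.1 hv
  exact expUnitary_mem_connectedIdealUnitary (by simp) (TwoSidedIdeal.mem_top A)

theorem expUnitary_mem_connectedUnitary (a : selfAdjoint A) : expUnitary a ∈ connectedUnitary A := by
  rw [← connectedIdealUnitary_top]
  exact expUnitary_mem_connectedIdealUnitary (by simp) (TwoSidedIdeal.mem_top A)

theorem conj_mem_connectedIdealUnitary {I : TwoSidedIdeal A} (hI : IsClosed (I : Set A))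
    (u : unitary A) : ∀ x ∈ connectedIdealUnitary I, u * x * u⁻¹ ∈ connectedIdealUnitary I := by
  intro x hx
  rw [connectedIdealUnitary_eq_closure hI] at hx
  change MulAut.conj u x ∈ _
  induction hx using Subgroup.closure_induction with
  | mem x hx =>
    obtain ⟨a, ha, rfl⟩ := hx
    rw [MulAut.conj_apply, ← expUnitary_unitaryConj]
    exact expUnitary_mem_connectedIdealUnitary hI (I.mul_mem_right _ _ (I.mul_mem_left _ _ ha))
  | one => simp
  | mul x y _ _ hx hy => rw [map_mul]; exact mul_mem hx hy
  | inv x _ hx => rw [map_inv]; exact inv_mem hx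

theorem CU_le_idealUnitary {I : TwoSidedIdeal A} (hI : IsClosed (I : Set A)) :
    CU I ≤ idealUnitary I :=
  closedCommutator_le (isClosed_idealUnitary hI)
    ((Subgroup.commutator_le_self _).trans (connectedIdealUnitary_le_idealUnitary I))

theorem conj_mem_CU {I : TwoSidedIdeal A} (hI : IsClosed (I : Set A)) (u : unitary A) :
    ∀ x ∈ CU I, u * x * u⁻¹ ∈ CU I :=
  conj_mem_closedCommutator (conj_mem_connectedIdealUnitary hI u)

theorem commutator_mem_of_mem_idealUnitary {I : TwoSidedIdeal A} {u : unitary A}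
    (hu : u ∈ idealUnitary I) (a : A) : (u : A) * a - a * u ∈ I := by
  have := commutator_mem_ideal_left (x := (u : A) - 1) hu a
  have e : ((u : A) - 1) * a - a * ((u : A) - 1) = (u : A) * a - a * u := by noncomm_ring
  rwa [e] at this

end Components

/-! ### Closed normal subgroups and closed ideals -/

section Correspondence

variable {A : Type*} [CStarAlgebra A]

/-- The closed ideal generated by `[K, A]`, for a group `K` of unitaries. -/
def commutatorIdeal (K : Subgroup (unitary A)) : TwoSidedIdeal A :=
  closedIdealSpan {z : A | ∃ u ∈ K, ∃ a : A, z = (u : A) * a - a * u}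

theorem isClosed_commutatorIdeal (K : Subgroup (unitary A)) :
    IsClosed (commutatorIdeal K : Set A) :=
  isClosed_closedIdealSpan _

theorem commutator_mem_commutatorIdeal {K : Subgroup (unitary A)} {u : unitary A} (hu : u ∈ K)
    (a : A) : (u : A) * a - a * u ∈ commutatorIdeal K :=
  subset_closedIdealSpan _ ⟨u, hu, a, rfl⟩

theorem commutatorIdeal_le {K : Subgroup (unitary A)} {J : TwoSidedIdeal A}
    (hJ : IsClosed (J : Set A)) (h : ∀ u ∈ K, ∀ a : A, (u : A) * a - a * u ∈ J) :
    commutatorIdeal K ≤ J := by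
  refine closedIdealSpan_le hJ ?_
  rintro _ ⟨u, hu, a, rfl⟩
  exact h u hu a

/-- If the Lie algebra of a closed subgroup `K` normalized by `U_A` contains `[I, A]`, then `K`
contains `(U_I, U_A)`. -/
theorem commutator_connectedIdealUnitary_le {K : Subgroup (unitary A)}
    (hK : IsClosed (K : Set (unitary A)))
    (hn : ∀ u ∈ connectedUnitary A, ∀ h ∈ K, u * h * u⁻¹ ∈ K) {I : TwoSidedIdeal A}
    (hI : IsClosed (I : Set A)) (hL : ∀ a ∈ I, ∀ x : A, a * x - x * a ∈ complexLie K hK) :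
    ⁅connectedIdealUnitary I, connectedUnitary A⁆ ≤ K := by
  rw [← connectedIdealUnitary_top, connectedIdealUnitary_eq_closure hI,
    connectedIdealUnitary_eq_closure (by simp)]
  refine commutator_closure_le (N := connectedUnitary A) hn ?_ ?_ ?_
  · rintro _ ⟨a, -, rfl⟩
    exact expUnitary_mem_connectedUnitary a
  · rintro _ ⟨a, -, rfl⟩
    exact expUnitary_mem_connectedUnitary a
  · rintro _ ⟨a, ha, rfl⟩ _ ⟨b, -, rfl⟩
    rw [commutatorElement_def, ← expUnitary_unitaryConj]
    refine expUnitary_mul_inv_mem hK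
      (fun t h hh => hn _ (expUnitary_mem_connectedUnitary _) h hh) ?_
    exact expUnitary_conj_sub_mem (isClosed_complexLie hK) (hL a ha) b

theorem commutator_mem_complexLie_of_normal {K : Subgroup (unitary A)}
    (hK : IsClosed (K : Set (unitary A)))
    (hn : ∀ u ∈ connectedUnitary A, ∀ h ∈ K, u * h * u⁻¹ ∈ K) {x : A} (hx : x ∈ complexLie K hK)
    (a : A) : x * a - a * x ∈ complexLie K hK := by
  refine mem_comap_commutatorRight.1 (complexLie_le hK (fun b hb => ?_) hx)
  refine mem_comap_commutatorRight.2 (mem_comap_commutatorLeft.1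
    (mem_of_forall_selfAdjoint_mem (fun c => mem_comap_commutatorLeft.2 ?_) a))
  refine commutator_mem_complexLie hK fun s t => ?_
  have h1 := hn _ (expUnitary_mem_connectedUnitary (t • c)) _ (K.inv_mem (hb s))
  have := K.mul_mem (hb s) h1
  simpa only [commutatorElement_def, mul_assoc] using this

theorem conj_sub_mem_complexLie {K : Subgroup (unitary A)} (hK : IsClosed (K : Set (unitary A)))
    (hn : ∀ u ∈ connectedUnitary A, ∀ h ∈ K, u * h * u⁻¹ ∈ K) {u : unitary A} (hu : u ∈ K) (x : A) :
    (u : A) * x * star (u : A) - x ∈ complexLie K hK := by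
  have hmem : ∀ y : A, y ∈ (complexLie K hK).comap
      (LinearMap.mulRight ℂ (star (u : A)) ∘ₗ LinearMap.mulLeft ℂ (u : A) - LinearMap.id) ↔
        (u : A) * y * star (u : A) - y ∈ complexLie K hK := fun y => by simp
  refine (hmem x).1 (mem_of_forall_selfAdjoint_mem (fun a => (hmem a).2 ?_) x)
  refine unitaryConj_sub_mem_complexLie hK fun t => ?_
  have h1 := hn _ (expUnitary_mem_connectedUnitary (t • a)) _ (K.inv_mem hu)
  have := K.mul_mem hu h1
  simpa only [commutatorElement_def, mul_assoc] using this

/-- The Lie algebra of a closed subgroup `K` normalized by `U_A` contains `[I, A]`, where `I` is the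
closed ideal generated by `[K, A]`. -/
theorem commutator_mem_complexLie_of_mem_commutatorIdeal {K : Subgroup (unitary A)}
    (hK : IsClosed (K : Set (unitary A)))
    (hn : ∀ u ∈ connectedUnitary A, ∀ h ∈ K, u * h * u⁻¹ ∈ K) {y : A} (hy : y ∈ commutatorIdeal K)
    (a : A) : y * a - a * y ∈ complexLie K hK := by
  refine commutator_mem_of_mem_closedIdealSpan_commutator (isClosed_complexLie hK)
    (fun x hx a => commutator_mem_complexLie_of_normal hK hn hx a) ?_ a
  refine commutatorIdeal_le (isClosed_closedIdealSpan _) (fun u hu a => ?_) hy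
  refine commutator_mem_of_conj_sub_central (isClosed_closedIdealSpan _) u.2 (fun a b => ?_) a
  exact subset_closedIdealSpan _ ⟨_, conj_sub_mem_complexLie hK hn hu a, b, rfl⟩

/-- A closed subgroup `K` normalized by `U_A` contains `CU_I` for the closed ideal `I` generated by
`[K, A]`. -/
theorem CU_commutatorIdeal_le {K : Subgroup (unitary A)} (hK : IsClosed (K : Set (unitary A)))
    (hn : ∀ u ∈ connectedUnitary A, ∀ h ∈ K, u * h * u⁻¹ ∈ K) : CU (commutatorIdeal K) ≤ K :=
  closedCommutator_le hK ((Subgroup.commutator_mono le_rfl (connectedIdealUnitary_le _)).trans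
    (commutator_connectedIdealUnitary_le hK hn (isClosed_commutatorIdeal K)
      fun _ ha => commutator_mem_complexLie_of_mem_commutatorIdeal hK hn ha))

theorem isClosed_CU (I : TwoSidedIdeal A) : IsClosed (CU I : Set (unitary A)) :=
  isClosed_closedCommutator _

theorem idealSubmodule_le {I : TwoSidedIdeal A} (hI : IsClosed (I : Set A)) {N : Submodule ℂ A}
    (h : ∀ a : selfAdjoint A, (a : A) ∈ I → (a : A) ∈ N) : idealSubmodule I ≤ N := by
  intro x hx
  have hs : star x ∈ idealSubmodule I := star_mem_ideal hI hx
  have hsmul : ∀ (r : ℝ) {y : A}, y ∈ idealSubmodule I → r • y ∈ idealSubmodule I :=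
    fun r _ hy => ((idealSubmodule I).restrictScalars ℝ).smul_mem r hy
  rw [← realPart_add_I_smul_imaginaryPart x]
  refine N.add_mem (h _ ?_) (N.smul_mem _ (h _ ?_))
  · rw [realPart_apply_coe]
    exact hsmul _ (add_mem hx hs)
  · rw [imaginaryPart_apply_coe]
    exact Submodule.smul_mem _ _ (hsmul _ (sub_mem hx hs))

theorem commutatorSpan_le_complexLie_CU {I : TwoSidedIdeal A} (hI : IsClosed (I : Set A)) :
    commutatorSpan (I : Set A) (I : Set A) ≤ complexLie (CU I) (isClosed_CU I) := by
  refine Submodule.span_le.2 ?_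
  rintro _ ⟨x, hx, y, hy, rfl⟩
  refine mem_comap_commutatorRight.1 (idealSubmodule_le hI (fun a ha => ?_) hx)
  refine mem_comap_commutatorRight.2 (mem_comap_commutatorLeft.1
    (idealSubmodule_le hI (fun b hb => mem_comap_commutatorLeft.2 ?_) hy))
  refine commutator_mem_complexLie _ fun s t => commutator_le_closedCommutator _ ?_
  exact Subgroup.commutator_mem_commutator
    (expUnitary_mem_connectedIdealUnitary hI (smul_coe_mem_ideal I ha s))
    (expUnitary_mem_connectedIdealUnitary hI (smul_coe_mem_ideal I hb t))

/-- `CU_I` contains `(U_I, U_A)`, the group version of `[I, A] ⊆ closure [I, I]`. -/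
theorem commutator_connectedUnitary_le_CU {I : TwoSidedIdeal A} (hI : IsClosed (I : Set A)) :
    ⁅connectedIdealUnitary I, connectedUnitary A⁆ ≤ CU I := by
  refine commutator_connectedIdealUnitary_le (isClosed_CU I) (fun u _ => conj_mem_CU hI u) hI
    fun a ha x => ?_
  exact Submodule.topologicalClosure_minimal _ (commutatorSpan_le_complexLie_CU hI)
    (isClosed_complexLie _) (commutator_mem_closure_commutatorSpan I ha x)

theorem commutator_mem_complexLie_closedCommutator {H : Subgroup (unitary A)}
    (hH : IsClosed (H : Set (unitary A))) {x y : A} (hx : x ∈ complexLie H hH)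
    (hy : y ∈ complexLie H hH) :
    x * y - y * x ∈ complexLie (closedCommutator H) (isClosed_closedCommutator H) := by
  refine mem_comap_commutatorRight.1 (complexLie_le hH (fun a ha => ?_) hx)
  refine mem_comap_commutatorRight.2 (mem_comap_commutatorLeft.1
    (complexLie_le hH (fun b hb => mem_comap_commutatorLeft.2 ?_) hy))
  exact commutator_mem_complexLie _ fun s t => commutator_le_closedCommutator _
    (Subgroup.commutator_mem_commutator (ha s) (hb t))

/-- If `H` is central modulo `J`, so is its Lie algebra. -/
theorem commutator_mem_of_mem_complexLie {H : Subgroup (unitary A)}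
    (hH : IsClosed (H : Set (unitary A))) {J : TwoSidedIdeal A} (hJ : IsClosed (J : Set A))
    (h : ∀ u ∈ H, ∀ a : A, (u : A) * a - a * u ∈ J) {x : A} (hx : x ∈ complexLie H hH) (a : A) :
    x * a - a * x ∈ J := by
  refine (mem_comap_commutatorRight (M := idealSubmodule J)).1
    (complexLie_le hH (fun b hb => mem_comap_commutatorRight.2 ?_) hx)
  have hd := ((hasDerivAt_expUnitary b 0).mul_const a).sub
    ((hasDerivAt_expUnitary b 0).const_mul a)
  have h1 := deriv_mem_of_forall_sub_mem (M := idealSubmodule J) hJ hd fun s => by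
    simpa [mem_idealSubmodule] using h _ (hb s) a
  simp only [zero_smul, expUnitary_zero, OneMemClass.coe_one, mul_one] at h1
  have h2 := (idealSubmodule J).smul_mem (-I) h1
  have e : -I • (I • (b : A) * a - a * I • (b : A)) = (b : A) * a - a * b := by
    simp [smul_sub, smul_smul]
  rwa [e] at h2

/-- A perfect ideal `I` is contained in every closed ideal modulo which the closed commutator
subgroup of `CU_I` is central. -/
theorem IsPerfectIdeal.le_of_commutator_mem {I : TwoSidedIdeal A} (hI : IsPerfectIdeal I)
    {J : TwoSidedIdeal A} (hJ : IsClosed (J : Set A))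
    (h : ∀ u ∈ closedCommutator (CU I), ∀ a : A, (u : A) * a - a * u ∈ J) : I ≤ J := by
  refine hI.2.le.trans (closedIdealSpan_le hJ ?_)
  refine Submodule.span_le (p := idealSubmodule J) |>.2 ?_
  rintro _ ⟨x, hx, y, hy, rfl⟩
  refine commutator_mem_of_commutator_commutator_mem hI.1 hJ (fun x hx y hy b => ?_) hx hy
  exact commutator_mem_of_mem_complexLie (isClosed_closedCommutator (CU I)) hJ h
    (commutator_mem_complexLie_closedCommutator (isClosed_CU I)
      (commutatorSpan_le_complexLie_CU hI.1 hx) (commutatorSpan_le_complexLie_CU hI.1 hy)) b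

/-- A perfect ideal is recovered from its group `CU_I`. -/
theorem IsPerfectIdeal.commutatorIdeal_CU {I : TwoSidedIdeal A} (hI : IsPerfectIdeal I) :
    commutatorIdeal (CU I) = I := by
  refine le_antisymm (commutatorIdeal_le hI.1 fun u hu =>
    commutator_mem_of_mem_idealUnitary (CU_le_idealUnitary hI.1 hu)) ?_
  refine hI.le_of_commutator_mem (isClosed_commutatorIdeal _) fun u hu =>
    commutator_mem_commutatorIdeal ?_
  exact closedCommutator_le (isClosed_CU I) (Subgroup.commutator_le_self _) hu

theorem IsPerfectIdeal.isTopologicallyPerfect_CU {I : TwoSidedIdeal A} (hI : IsPerfectIdeal I) :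
    IsTopologicallyPerfect (CU I) := by
  refine le_antisymm ?_ (closedCommutator_le (isClosed_CU I) (Subgroup.commutator_le_self _))
  have hIJ : I ≤ commutatorIdeal (closedCommutator (CU I)) :=
    hI.le_of_commutator_mem (isClosed_commutatorIdeal _) fun u hu =>
      commutator_mem_commutatorIdeal hu
  exact (CU_mono hIJ).trans (CU_commutatorIdeal_le (isClosed_closedCommutator _)
    fun u _ => conj_mem_closedCommutator (conj_mem_CU hI.1 u))

/-- Group commutators of unitaries in `1 + I` belong to `1 + J` as soon as `[I, I] ⊆ J`. -/
theorem commutator_idealUnitary_le {I J : TwoSidedIdeal A}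
    (h : ∀ x ∈ I, ∀ y ∈ I, x * y - y * x ∈ J) :
    ⁅idealUnitary I, idealUnitary I⁆ ≤ idealUnitary J := by
  rw [Subgroup.commutator_le]
  intro u hu v hv
  change ((⁅u, v⁆ : unitary A) : A) - 1 ∈ J
  have e1 : ((u : A) - 1) * ((v : A) - 1) - ((v : A) - 1) * ((u : A) - 1) =
      ((u * v : unitary A) : A) - ((v * u : unitary A) : A) := by
    push_cast
    noncomm_ring
  have e2 : ((⁅u, v⁆ : unitary A) : A) - 1 =
      (((u * v : unitary A) : A) - ((v * u : unitary A) : A)) *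
        (((v * u)⁻¹ : unitary A) : A) := by
    rw [sub_mul, ← Submonoid.coe_mul, ← Submonoid.coe_mul, mul_inv_cancel, OneMemClass.coe_one,
      commutatorElement_def, mul_inv_rev, mul_assoc (u * v)]
  rw [e2, ← e1]
  exact J.mul_mem_right _ _ (h _ hu _ hv)

/-- For a group `K ≤ U_A` that is central modulo `I`, the commutators lie not only in `1 + I`, but
in the identity component `U_I`, since `U_A` is connected. -/
theorem commutator_le_connectedIdealUnitary {K : Subgroup (unitary A)}
    (hKU : K ≤ connectedUnitary A) {I : TwoSidedIdeal A}
    (h : ∀ u ∈ K, ∀ a : A, (u : A) * a - a * u ∈ I) : ⁅K, K⁆ ≤ connectedIdealUnitary I := by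
  rw [Subgroup.commutator_le]
  intro u hu v hv
  have : PreconnectedSpace (connectedUnitary A) :=
    Subtype.preconnectedSpace isPreconnected_connectedComponent
  refine mem_connectedIdealUnitary_of_continuous (X := connectedUnitary A)
    (f := fun g => ⁅u, (g : unitary A)⁆) (x₀ := 1) ?_ (fun g => ?_) (by simp) ⟨v, hKU hv⟩
  · simp only [commutatorElement_def]
    fun_prop
  · change ((⁅u, (g : unitary A)⁆ : unitary A) : A) - 1 ∈ I
    have e : ((⁅u, (g : unitary A)⁆ : unitary A) : A) - 1 =
        ((u : A) * ((g : unitary A) : A) - ((g : unitary A) : A) * (u : A)) *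
          ((((g : unitary A) * u)⁻¹ : unitary A) : A) := by
      rw [sub_mul, ← Submonoid.coe_mul, ← Submonoid.coe_mul, ← Submonoid.coe_mul,
        ← Submonoid.coe_mul, mul_inv_cancel, OneMemClass.coe_one,
        commutatorElement_def, mul_inv_rev, mul_assoc (u * (g : unitary A))]
    rw [e]
    exact I.mul_mem_right _ _ (h u hu _)

/-- A topologically perfect closed subgroup `K` of `U_A` normalized by `U_A` is `CU_I` for the
closed ideal `I` generated by `[K, A]`. The inclusion `K ≤ CU_I` follows from
`(K, K) ≤ closure ((K, K), K) ≤ closure (U_I, U_A)`. -/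
theorem IsTopologicallyPerfect.CU_commutatorIdeal_eq {K : Subgroup (unitary A)}
    (hp : IsTopologicallyPerfect K) (hKU : K ≤ connectedUnitary A)
    (hn : ∀ u ∈ connectedUnitary A, ∀ h ∈ K, u * h * u⁻¹ ∈ K) : CU (commutatorIdeal K) = K := by
  have hK : IsClosed (K : Set (unitary A)) := by
    rw [hp]
    exact isClosed_closedCommutator K
  refine le_antisymm (CU_commutatorIdeal_le hK hn) (hp.le.trans ?_)
  set I := commutatorIdeal K
  have hI : IsClosed (I : Set A) := isClosed_commutatorIdeal K
  refine closedCommutator_le (isClosed_CU I) ?_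
  rw [Subgroup.commutator_le]
  intro u hu v hv
  have hmaps : Set.MapsTo (fun x => ⁅x, v⁆) (⁅K, K⁆ : Subgroup (unitary A))
      (CU I : Set (unitary A)) := fun x hx =>
    commutator_connectedUnitary_le_CU hI (Subgroup.commutator_mem_commutator
      (commutator_le_connectedIdealUnitary hKU (fun _ h => commutator_mem_commutatorIdeal h) hx)
      (hKU hv))
  have hc : Continuous fun x : unitary A => ⁅x, v⁆ := by
    simp only [commutatorElement_def]
    fun_prop
  have huc : u ∈ closure ((⁅K, K⁆ : Subgroup (unitary A)) : Set (unitary A)) := by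
    rw [hp] at hu
    exact hu
  exact (isClosed_CU I).closure_subset (hmaps.closure hc huc)

/-- If `CU_I = K` for the closed ideal `I` generated by `[K, A]`, then `I` is perfect, as `CU_I` is
contained in `1 + J` for the closed ideal `J` generated by `[I, I]`. -/
theorem isPerfectIdeal_commutatorIdeal {K : Subgroup (unitary A)}
    (h : CU (commutatorIdeal K) = K) : IsPerfectIdeal (commutatorIdeal K) := by
  have hI := isClosed_commutatorIdeal K
  refine ⟨hI, le_antisymm ?_ (closedIdealSpan_commutatorSpan_le hI)⟩
  set J := closedIdealSpan
    (commutatorSpan (commutatorIdeal K : Set A) (commutatorIdeal K : Set A) : Set A)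
  have hJ : IsClosed (J : Set A) := isClosed_closedIdealSpan _
  have hKJ : K ≤ idealUnitary J := by
    rw [← h]
    refine closedCommutator_le (isClosed_idealUnitary hJ)
      ((Subgroup.commutator_mono (connectedIdealUnitary_le_idealUnitary _)
        (connectedIdealUnitary_le_idealUnitary _)).trans (commutator_idealUnitary_le ?_))
    exact fun x hx y hy => subset_closedIdealSpan _ (mul_sub_mul_mem_commutatorSpan hx hy)
  exact commutatorIdeal_le hJ fun u hu => commutator_mem_of_mem_idealUnitary (hKJ hu)

theorem isTopologicallyPerfect_map_subtype_iff {H : Subgroup (connectedUnitary A)} :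
    IsTopologicallyPerfect (H.map (connectedUnitary A).subtype) ↔ IsTopologicallyPerfect H := by
  unfold IsTopologicallyPerfect
  rw [← map_closedCommutator isClosed_connectedUnitary]
  exact (Subgroup.map_injective (connectedUnitary A).subtype_injective).eq_iff

end Correspondence

end CStarUnitary

open CStarUnitary in
theorem mainTheorem3 {A : Type*} [CStarAlgebra A] :
    Set.BijOn (fun I : TwoSidedIdeal A => CStarUnitary.CUIn I)
      {I : TwoSidedIdeal A | CStarUnitary.IsPerfectIdeal I}
      {H : Subgroup (CStarUnitary.connectedUnitary A) |
        IsClosed (H : Set (CStarUnitary.connectedUnitary A)) ∧ H.Normal ∧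
          CStarUnitary.IsTopologicallyPerfect H} := by
  refine ⟨fun I hI => ⟨?_, ⟨fun n hn g => ?_⟩, ?_⟩, fun I hI J hJ hIJ => ?_, fun H hH => ?_⟩
  · exact (isClosed_CU I).preimage continuous_subtype_val
  · exact conj_mem_CU hI.1 (g : unitary A) n hn
  · rw [← isTopologicallyPerfect_map_subtype_iff, map_CUIn]
    exact hI.isTopologicallyPerfect_CU
  · have h := congrArg (Subgroup.map (connectedUnitary A).subtype) hIJ
    simp only [map_CUIn] at h
    rw [← hI.commutatorIdeal_CU, h, hJ.commutatorIdeal_CU]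
  · obtain ⟨-, hnormal, hp⟩ := hH
    set K := H.map (connectedUnitary A).subtype with hKdef
    have hK : CU (commutatorIdeal K) = K := by
      refine (isTopologicallyPerfect_map_subtype_iff.2 hp).CU_commutatorIdeal_eq
        (Subgroup.map_subtype_le H) ?_
      rintro u hu _ ⟨x, hx, rfl⟩
      exact ⟨_, hnormal.conj_mem x hx ⟨u, hu⟩, rfl⟩
    refine ⟨commutatorIdeal K, isPerfectIdeal_commutatorIdeal hK, ?_⟩
    apply Subgroup.map_injective (connectedUnitary A).subtype_injective
    change (CUIn _).map _ = _
    rw [map_CUIn, hK]
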